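/- Let $(\mathcal X,\mathcal A)$ be a measurable space, $K\ge 2$, $\mathcal Y=\{1,\dots,K\}$, and let $D$ be a probability distribution on $\mathcal X\times\mathcal Y$ (the clean data). Let $\mathbf N=(\eta_{i,j})$ be an invertible $K\times K$ matrix with non-negative entries and row sums $1$ (the noise matrix), and let $D_\rho$ be the law of $(x,\tilde y)$, where $(x,y)\sim D$ and, given $(x,y)$, $\tilde y=j$ with probability $\eta_{y,j}$. Let $M=\max_y\sum_{j}|\mathbf N^{-1}_{y,j}|$. An ordinal regressor is a pair $f=(g,b)$ with $g:\mathcal X\to\mathbb R$ and $b\in\mathbb R^{K-1}$; its $i$-th binary score function is $f^i(x)=g(x)+b_i$, $1\le i\le K-1$. Let $z_i^y$ be the positive binary label if $i<y$ and the negative one if $i\ge y$. Let the loss be $l(f;x,y)=\sum_{i=1}^{K-1}l^i(f;x,y)$ with $l^i(f;x,y)=\ell^i(f^i(x),z_i^y)$, where every binary loss $t\mapsto\ell^i(t,z)$, $t\in\mathbb R$, is $L$-Lipschitz. The noise-corrected losses are $\tilde l(f;x,y)=\sum_j\mathbf N^{-1}_{y,j}\,l(f;x,j)$ and $\tilde l^i(f;x,y)=\sum_j\mathbf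 N^{-1}_{y,j}\,l^i(f;x,j)$. Let $\mathcal F$ be a class of ordinal regressors with measurable $g$'s which has a countable subclass such that the scores $(f^1,\dots,f^{K-1})$ of every $f\in\mathcal F$ are pointwise limits of those of a sequence from the subclass. Assume that for each $f\in\mathcal F$ and $i$ any two values of $\tilde l^i(f;\cdot,\cdot)$ on $\mathcal X\times\mathcal Y$ differ by at most $1$. For $n\ge 1$ put $$\mathfrak R(\mathcal F)=\max_{1\le i\le K-1}\ \mathbb E\Big[\sup_{f\in\mathcal F}\frac1n\sum_{k=1}^n\sigma_k f^i(x_k)\Big],$$ with $x_1,\dots,x_n$ independent with the law of $x$ under $D$ and $\sigma_1,\dots,\sigma_n$ independent uniform signs, and assume that these complexities are finite. Let $f^*$ minimize $R_{l,D}(f)=\mathbb E_{(x,y)\sim D}[l(f;x,y)]$ over $\mathcal F$, and let $0<\delta<1$. Then with probability at least $1-\delta$ over a sample $S=((x_k,\tilde y_k))_{k=1}^n$ drawn independently from $D_\rho$, every minimizer $\hat f$ over $\mathcal F$ of the empirical risk $\hat R_{\tilde l,S}(f)=\frac1n\sum_{k=1}^n\tilde l(f;x_k,\tilde y_k)$ satisfies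 $$R_{l,D}(\hat f)\le R_{l,D}(f^*)+2(K-1)\Big(2ML\,\mathfrak R(\mathcal F)+\sqrt{\frac{\log(1/\delta)}{2n}}\Big).$$ -/

import Mathlib

open MeasureTheory Filter Topology
open scoped NNReal

/-- An ordinal regressor with `K` classes: a real-valued function `g` on the feature space and
`K - 1` thresholds `b`. Classes and thresholds are indexed from `0`: the label `y : Fin K` stands
for the class `y + 1` and the index `i : Fin (K - 1)` for the threshold `i + 1`. -/
structure OrdinalRegressor (X : Type*) (K : ℕ) where
  g : X → ℝ
  b : Fin (K - 1) → ℝ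

namespace OrdinalRegressor

/-- The real score `g x + b i` of the `i`-th of the `K - 1` binary classifiers. -/
def binaryScore {X : Type*} {K : ℕ} (f : OrdinalRegressor X K) (i : Fin (K - 1)) (x : X) : ℝ :=
  f.g x + f.b i

end OrdinalRegressor

/-- The label seen by the `i`-th binary classifier when the class is `y`: positive (`true`) if
`i < y`, negative (`false`) if `i ≥ y`. -/
def binaryLabel {K : ℕ} (i : Fin (K - 1)) (y : Fin K) : Bool :=
  decide ((i : ℕ) < (y : ℕ))

/-- The binary loss suffered by the `i`-th binary classifier of `f` at `(x, y)`, where `ℓ i t z`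
is the loss of the real score `t` for the binary label `z`. -/
def binaryLoss {X : Type*} {K : ℕ} (ℓ : Fin (K - 1) → ℝ → Bool → ℝ) (i : Fin (K - 1))
    (f : OrdinalRegressor X K) (p : X × Fin K) : ℝ :=
  ℓ i (f.binaryScore i p.1) (binaryLabel i p.2)

/-- The ordinal loss, the sum of the `K - 1` binary losses. -/
def ordinalLoss {X : Type*} {K : ℕ} (ℓ : Fin (K - 1) → ℝ → Bool → ℝ)
    (f : OrdinalRegressor X K) (p : X × Fin K) : ℝ :=
  ∑ i, binaryLoss ℓ i f p

/-- The noise correction of a loss `l` of `f` at `(x, y)`: with the noise matrix `N`, it is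
`∑ j, N⁻¹ y j * l f (x, j)`. -/
noncomputable def corrected {X : Type*} {K : ℕ} (N : Matrix (Fin K) (Fin K) ℝ)
    (l : OrdinalRegressor X K → X × Fin K → ℝ) (f : OrdinalRegressor X K) (p : X × Fin K) : ℝ :=
  ∑ j, N⁻¹ p.2 j * l f (p.1, j)

/-- `N` is an invertible noise matrix: `N i j` is the probability of observing the label `j`
when the true label is `i`. -/
structure IsNoiseMatrix {K : ℕ} (N : Matrix (Fin K) (Fin K) ℝ) : Prop where
  nonneg : ∀ i j, 0 ≤ N i j
  row_sum : ∀ i, ∑ j, N i j = 1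
  invertible : IsUnit N.det

/-- The constant `max_y ∑ j, |N⁻¹ y j|`. -/
noncomputable def noiseConstant {K : ℕ} (N : Matrix (Fin K) (Fin K) ℝ) : ℝ :=
  ⨆ y, ∑ j, |N⁻¹ y j|

/-- The law of `(x, y')` when `(x, y)` has law `D` and, given `(x, y)`, the noisy label `y'`
equals `j` with probability `N y j`. -/
noncomputable def noisyLaw {X : Type*} [MeasurableSpace X] {K : ℕ}
    (N : Matrix (Fin K) (Fin K) ℝ) (D : Measure (X × Fin K)) : Measure (X × Fin K) :=
  ∑ j, (D.withDensity fun p => ENNReal.ofReal (N p.2 j)).map fun p => (p.1, j)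

/-- The risk of `f` for the loss `l` under the law `D`. -/
noncomputable def risk {X : Type*} [MeasurableSpace X] {K : ℕ}
    (l : OrdinalRegressor X K → X × Fin K → ℝ) (D : Measure (X × Fin K))
    (f : OrdinalRegressor X K) : ℝ :=
  ∫ p, l f p ∂D

/-- The empirical risk of `f` for the loss `l` on the sample `S`. -/
noncomputable def empiricalRisk {X : Type*} {K n : ℕ}
    (l : OrdinalRegressor X K → X × Fin K → ℝ) (S : Fin n → X × Fin K)
    (f : OrdinalRegressor X K) : ℝ :=
  (1 / (n : ℝ)) * ∑ k, l f (S k)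

/-- `f` minimizes `r` over the class `F`. -/
def IsMinimizer {X : Type*} {K : ℕ} (r : OrdinalRegressor X K → ℝ)
    (F : Set (OrdinalRegressor X K)) (f : OrdinalRegressor X K) : Prop :=
  f ∈ F ∧ ∀ h ∈ F, r f ≤ r h

/-- The class of score functions of the `i`-th binary classifiers of the members of `F`. -/
def binaryClass {X : Type*} {K : ℕ} (F : Set (OrdinalRegressor X K)) (i : Fin (K - 1)) :
    Set (X → ℝ) :=
  (fun f => f.binaryScore i) '' F

/-- The sign `1` or `-1` encoded by a Boolean. -/
def rademacherSign (s : Bool) : ℝ := if s then 1 else -1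

/-- The set of all `(1 / n) * ∑ k, σ k * h (x k)` with `h ∈ H`. -/
def signedMeans {X : Type*} {n : ℕ} (H : Set (X → ℝ)) (x : Fin n → X) (σ : Fin n → Bool) :
    Set ℝ :=
  (fun h : X → ℝ => (1 / (n : ℝ)) * ∑ k, rademacherSign (σ k) * h (x k)) '' H

/-- The empirical Rademacher complexity of `H` at the points `x`: the average, over the uniformly
distributed sign vectors `σ`, of `sup_{h ∈ H} (1 / n) * ∑ k, σ k * h (x k)`. -/
noncomputable def empiricalRademacher {X : Type*} {n : ℕ} (H : Set (X → ℝ)) (x : Fin n → X) : ℝ :=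
  (1 / (2 : ℝ) ^ n) * ∑ σ : Fin n → Bool, sSup (signedMeans H x σ)

/-- The Rademacher complexity of `H` for `n` independent points with law `P`. -/
noncomputable def rademacher {X : Type*} [MeasurableSpace X] (n : ℕ) (P : Measure X)
    (H : Set (X → ℝ)) : ℝ :=
  ∫ x, empiricalRademacher H x ∂(Measure.pi fun _ : Fin n => P)

/-- The Rademacher complexity of `H` is finite (so that the suprema and the expectation in its
definition are genuine). -/
def FiniteRademacher {X : Type*} [MeasurableSpace X] (n : ℕ) (P : Measure X)
    (H : Set (X → ℝ)) : Prop :=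
  (∀ᵐ x ∂(Measure.pi fun _ : Fin n => P), ∀ σ : Fin n → Bool, BddAbove (signedMeans H x σ)) ∧
    Integrable (fun x : Fin n → X => empiricalRademacher H x) (Measure.pi fun _ : Fin n => P)

/-- The Rademacher complexity of a class of ordinal regressors: the largest one among those of its
`K - 1` classes of binary score functions. -/
noncomputable def ordinalRademacher {X : Type*} [MeasurableSpace X] {K : ℕ} (n : ℕ)
    (P : Measure X) (F : Set (OrdinalRegressor X K)) : ℝ :=
  ⨆ i, rademacher n P (binaryClass F i)

/-- The usual measurability requirement on a class of functions (for suprema over the class to be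
measurable): its members are measurable, and every member is the pointwise limit of a sequence
from one fixed countable subclass. -/
structure IsMeasurableClass {X : Type*} [MeasurableSpace X] {K : ℕ}
    (F : Set (OrdinalRegressor X K)) : Prop where
  measurable : ∀ f ∈ F, Measurable f.g
  separable : ∃ F₀ ⊆ F, F₀.Countable ∧ ∀ f ∈ F, ∃ u : ℕ → OrdinalRegressor X K,
    (∀ m, u m ∈ F₀) ∧
      ∀ i x, Tendsto (fun m => (u m).binaryScore i x) atTop (𝓝 (f.binaryScore i x))

/-!
The corrected loss `corrected N l` has, under the noisy law, the risk of `l` under the clean law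
(`integral_corrected_noisyLaw`), because `N * N⁻¹ = 1`. So the statement is about a uniform
deviation of empirical means from their expectations under the noisy law.

Write `R` and `r S` for the expected and the empirical corrected risk. Since an empirical minimizer
`fhat` has `r S fhat ≤ r S fstar`, its excess risk is at most
`φ S = sup_f ((R f - r S f) - (R fstar - r S fstar))`. The comparison with `fstar` stays inside the
supremum, so that a single concentration inequality is needed and no union bound is: one point of
the sample changes `φ` by at most `2 * (K - 1) / n`, and McDiarmid's inequality
(`hasSubgaussianMGF_of_bounded_differences`) bounds `φ` by its expectation plus the square root term
with probability at least `1 - δ`.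

The term of `fstar` has expectation zero, and the supremum of the sum over the thresholds is at most
the sum of the suprema. Each of these has by symmetrization (`integral_iSup_deviation_le`) an
expectation of at most twice the Rademacher complexity of the corrected binary losses; these are
`noiseConstant N * L`-Lipschitz functions of the scores, one for each point of `X × Fin K`, so the
contraction principle (`bddAbove_and_sum_iSup_sign_le`) brings in the complexity of the scores. This
bounds the expectation of `φ` by half of the term allowed for it.

Suprema are taken over the countable subclass, where they are measurable, and reach the whole class
because deviations pass to pointwise limits (`tendsto_deviation`).
-/

/-! ### McDiarmid's bounded differences inequality -/

lemma integrable_of_forall_abs_le {Ω : Type*} [MeasurableSpace Ω] {μ : Measure Ω}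
    [IsFiniteMeasure μ] {φ : Ω → ℝ} (hφ : Measurable φ) {B : ℝ} (hB : ∀ ω, |φ ω| ≤ B) :
    Integrable φ μ :=
  Integrable.of_bound hφ.aestronglyMeasurable B (ae_of_all _ hB)

/-- **McDiarmid's inequality**, in its moment generating function form. Induction on `n`: averaging
`φ` over the first coordinate leaves a function of the others with the same bounded differences,
and conditionally on the others Hoeffding's lemma applies to the first coordinate. -/
theorem hasSubgaussianMGF_of_bounded_differences {Z : Type*} [MeasurableSpace Z] (P : Measure Z)
    [IsProbabilityMeasure P] (c : ℝ≥0) (B : ℝ) (n : ℕ) (φ : (Fin n → Z) → ℝ) (hφ : Measurable φ)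
    (hB : ∀ S, |φ S| ≤ B)
    (hdiff : ∀ (k : Fin n) (S T : Fin n → Z), (∀ j, j ≠ k → S j = T j) → φ S ≤ φ T + c) :
    ProbabilityTheory.HasSubgaussianMGF (fun S => φ S - ∫ T, φ T ∂(Measure.pi fun _ => P))
      (n * (c / 2) ^ 2) (Measure.pi fun _ => P) := by
  induction n with
  | zero =>
    have h0 : ∀ S, φ S = φ Fin.elim0 := fun S => congrArg φ (Subsingleton.elim _ _)
    have : (fun S => φ S - ∫ T, φ T ∂(Measure.pi fun _ : Fin 0 => P)) = fun _ => 0 := by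
      funext S
      simp [h0]
    rw [this]
    simp
  | succ n ih =>
    have hP : Nonempty Z := nonempty_of_isProbabilityMeasure P
    set μ : Measure (Fin n → Z) := Measure.pi fun _ => P
    set ν : Measure (Fin (n + 1) → Z) := Measure.pi fun _ => P
    have hmp : MeasurePreserving (fun p : Z × (Fin n → Z) => (Fin.cons p.1 p.2 : Fin (n + 1) → Z))
        (P.prod μ) ν := by
      have h := (measurePreserving_piFinSuccAbove (fun _ : Fin (n + 1) => P) 0).symm
      convert h using 1
      funext p
      simp [MeasurableEquiv.piFinSuccAbove, Fin.insertNthEquiv]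
    have hcons := hmp.measurable
    have hcomp : ∀ F : (Fin (n + 1) → Z) → ℝ, Measurable F → (∃ C, ∀ S, |F S| ≤ C) →
        ∫ S, F S ∂ν = ∫ S, ∫ z, F (Fin.cons z S) ∂P ∂μ := by
      rintro F hF ⟨C, hC⟩
      rw [← hmp.map_eq, integral_map hcons.aemeasurable hF.aestronglyMeasurable]
      exact integral_prod_symm _ (integrable_of_forall_abs_le (hF.comp hcons) fun p => hC _)
    have hsec : ∀ S : Fin n → Z, Measurable fun z => φ (Fin.cons z S) := fun S =>
      (hφ.comp hcons).comp measurable_prodMk_right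
    have hint : ∀ S : Fin n → Z, Integrable (fun z => φ (Fin.cons z S)) P := fun S =>
      integrable_of_forall_abs_le (hsec S) fun z => hB _
    set ψ : (Fin n → Z) → ℝ := fun S => ∫ z, φ (Fin.cons z S) ∂P
    have hψm : Measurable ψ :=
      ((hφ.comp hcons).stronglyMeasurable.integral_prod_left').measurable
    have hψB : ∀ S, |ψ S| ≤ B := fun S => by
      have := norm_integral_le_of_norm_le_const (μ := P) (f := fun z => φ (Fin.cons z S)) (C := B)
        (ae_of_all _ fun z => hB _)
      simpa using this
    have hψd : ∀ (k : Fin n) (S T : Fin n → Z), (∀ j, j ≠ k → S j = T j) → ψ S ≤ ψ T + c := by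
      intro k S T h
      have : ψ T + c = ∫ z, (φ (Fin.cons z T) + c) ∂P := by
        rw [integral_add (hint T) (integrable_const _)]
        simp [ψ]
      rw [this]
      refine integral_mono (hint S) ((hint T).add (integrable_const _)) fun z => ?_
      refine hdiff k.succ _ _ fun j => ?_
      refine Fin.cases (fun _ => by simp) (fun j hj => ?_) j
      simpa using h j fun e => hj (by rw [e])
    have IH := ih ψ hψm hψB hψd
    have hEφ : ∫ S, φ S ∂ν = ∫ S, ψ S ∂μ := hcomp φ hφ ⟨B, hB⟩
    set m := ∫ S, ψ S ∂μ
    have hbdd : ∀ t : ℝ, ∀ S, |Real.exp (t * (φ S - m))| ≤ Real.exp (|t| * (B + |m|)) := by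
      intro t S
      rw [abs_of_pos (Real.exp_pos _)]
      refine Real.exp_le_exp.2 ((le_abs_self _).trans ?_)
      rw [abs_mul]
      gcongr
      exact (abs_sub _ _).trans (by gcongr; exact hB S)
    have hmeas : ∀ t : ℝ, Measurable fun S => Real.exp (t * (φ S - m)) := fun t => by fun_prop
    rw [hEφ]
    refine ⟨fun t => integrable_of_forall_abs_le (hmeas t) (hbdd t), fun t => ?_⟩
    have hHoeff : ∀ S : Fin n → Z, ∫ z, Real.exp (t * (φ (Fin.cons z S) - ψ S)) ∂P
        ≤ Real.exp ((c / 2) ^ 2 * t ^ 2 / 2) := by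
      intro S
      have hbelow : BddBelow (Set.range fun z => φ (Fin.cons z S)) :=
        ⟨-B, by rintro _ ⟨z, rfl⟩; exact (abs_le.1 (hB _)).1⟩
      have hmem : ∀ z, φ (Fin.cons z S) ∈ Set.Icc (⨅ z, φ (Fin.cons z S))
          ((⨅ z, φ (Fin.cons z S)) + c) := by
        intro z
        refine ⟨ciInf_le hbelow z, ?_⟩
        rw [← sub_le_iff_le_add]
        refine le_ciInf fun z' => sub_le_iff_le_add.2 (hdiff 0 _ _ fun j => ?_)
        refine Fin.cases (fun h => absurd rfl h) (fun j _ => by simp) j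
      have h := (ProbabilityTheory.hasSubgaussianMGF_of_mem_Icc (μ := P) (hsec S).aemeasurable
        (ae_of_all _ hmem)).mgf_le t
      simpa [ProbabilityTheory.mgf] using h
    calc ProbabilityTheory.mgf (fun S => φ S - m) ν t
        = ∫ S, ∫ z, Real.exp (t * (φ (Fin.cons z S) - m)) ∂P ∂μ :=
          hcomp _ (hmeas t) ⟨_, hbdd t⟩
      _ = ∫ S, Real.exp (t * (ψ S - m)) *
            ∫ z, Real.exp (t * (φ (Fin.cons z S) - ψ S)) ∂P ∂μ := by
          refine integral_congr_ae (ae_of_all _ fun S => ?_)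
          simp only
          rw [← integral_const_mul]
          refine integral_congr_ae (ae_of_all _ fun z => ?_)
          simp only
          rw [← Real.exp_add]
          ring_nf
      _ ≤ ∫ S, Real.exp (t * (ψ S - m)) * Real.exp ((c / 2) ^ 2 * t ^ 2 / 2) ∂μ := by
          refine integral_mono_of_nonneg (ae_of_all _ fun S => ?_)
            ((IH.integrable_exp_mul t).mul_const _) (ae_of_all _ fun S => ?_)
          · exact mul_nonneg (Real.exp_pos _).le (integral_nonneg fun z => (Real.exp_pos _).le)
          · exact mul_le_mul_of_nonneg_left (hHoeff S) (Real.exp_pos _).le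
      _ ≤ Real.exp (n * (c / 2) ^ 2 * t ^ 2 / 2) * Real.exp ((c / 2) ^ 2 * t ^ 2 / 2) := by
          rw [integral_mul_const]
          refine mul_le_mul_of_nonneg_right ?_ (Real.exp_pos _).le
          simpa [ProbabilityTheory.mgf] using IH.mgf_le t
      _ = Real.exp (((n + 1 : ℕ) * (c / 2) ^ 2 : ℝ≥0) * t ^ 2 / 2) := by
          rw [← Real.exp_add]
          push_cast
          ring_nf

/-! ### Contraction of Rademacher averages -/

lemma abs_rademacherSign (s : Bool) : |rademacherSign s| = 1 := by
  cases s <;> simp [rademacherSign]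

lemma rademacherSign_not (s : Bool) : rademacherSign (!s) = -rademacherSign s := by
  cases s <;> simp [rademacherSign]

lemma bddAbove_range_of_abs_le {ι : Type*} {a : ι → ℝ} {B : ℝ} (h : ∀ i, |a i| ≤ B) :
    BddAbove (Set.range a) :=
  ⟨B, by rintro _ ⟨i, rfl⟩; exact (abs_le.1 (h i)).2⟩

lemma abs_sum_sign_mul_le {n : ℕ} (σ : Fin n → Bool) (a : Fin n → ℝ) :
    |∑ k, rademacherSign (σ k) * a k| ≤ ∑ k, |a k| :=
  (Finset.abs_sum_le_sum_abs _ _).trans_eq (by simp [abs_mul, abs_rademacherSign])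

/-- The contraction principle for a single sign. -/
lemma iSup_add_iSup_le_of_lipschitz {ι : Type*} [Nonempty ι] {v a b : ι → ℝ} {C : ℝ}
    (hab : ∀ f g, |b f - b g| ≤ C * |a f - a g|)
    (hp : BddAbove (Set.range fun f => v f + C * a f))
    (hm : BddAbove (Set.range fun f => v f - C * a f)) :
    (⨆ f, (v f + b f)) + ⨆ f, (v f - b f) ≤ (⨆ f, (v f + C * a f)) + ⨆ f, (v f - C * a f) := by
  have key : ∀ f g, v f + b f + (v g - b g) ≤
      (⨆ f, (v f + C * a f)) + ⨆ f, (v f - C * a f) := by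
    intro f g
    have h := (le_abs_self _).trans (hab f g)
    have pf := le_ciSup hp f
    have pg := le_ciSup hp g
    have mf := le_ciSup hm f
    have mg := le_ciSup hm g
    rcases abs_cases (a f - a g) with ⟨e, _⟩ | ⟨e, _⟩ <;> rw [e] at h <;> linarith
  have h1 : ∀ g, (⨆ f, (v f + b f)) ≤
      (⨆ f, (v f + C * a f)) + (⨆ f, (v f - C * a f)) - (v g - b g) := fun g =>
    ciSup_le fun f => by linarith [key f g]
  have h2 : (⨆ f, (v f - b f)) ≤ (⨆ f, (v f + C * a f)) + (⨆ f, (v f - C * a f)) -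
      ⨆ f, (v f + b f) := ciSup_le fun g => by linarith [h1 g]
  linarith

lemma sum_fin_succ_bool {n : ℕ} (G : (Fin (n + 1) → Bool) → ℝ) :
    ∑ σ, G σ = ∑ σ : Fin n → Bool, (G (Fin.cons true σ) + G (Fin.cons false σ)) := by
  rw [← (Fin.consEquiv fun _ : Fin (n + 1) => Bool).sum_comp G, Fintype.sum_prod_type_right]
  simp [Fin.consEquiv]

/-- The **contraction principle** for Rademacher averages, the signs being replaced one at a time.
The additional function `u` is what makes the induction on the number of signs work. -/
theorem sum_iSup_sign_le_of_lipschitz {ι : Type*} [Nonempty ι] {C B : ℝ} (hC : 0 ≤ C) {n : ℕ}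
    (a b : Fin n → ι → ℝ) (hab : ∀ k f g, |b k f - b k g| ≤ C * |a k f - a k g|)
    (ha : ∀ k f, |a k f| ≤ B) (hb : ∀ k f, |b k f| ≤ B) (u : ι → ℝ) (hu : ∃ U, ∀ f, |u f| ≤ U) :
    ∑ σ : Fin n → Bool, ⨆ f, (u f + ∑ k, rademacherSign (σ k) * b k f) ≤
      ∑ σ : Fin n → Bool, ⨆ f, (u f + C * ∑ k, rademacherSign (σ k) * a k f) := by
  induction n generalizing u with
  | zero => simp
  | succ n ih =>
    obtain ⟨U, hU⟩ := hu
    have hstep : ∀ s : Bool,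
        ∑ σ : Fin n → Bool, ⨆ f, (u f + (rademacherSign s * b 0 f +
          ∑ k, rademacherSign (σ k) * b k.succ f)) ≤
        ∑ σ : Fin n → Bool, ⨆ f, ((u f + C * ∑ k, rademacherSign (σ k) * a k.succ f) +
          rademacherSign s * b 0 f) := by
      intro s
      have := ih (fun k => a k.succ) (fun k => b k.succ) (fun k => hab _) (fun k => ha _)
        (fun k => hb _) (fun f => u f + rademacherSign s * b 0 f) ⟨U + B, fun f => by
          refine (abs_add_le _ _).trans (add_le_add (hU f) ?_)
          rw [abs_mul, abs_rademacherSign, one_mul]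
          exact hb 0 f⟩
      refine Eq.trans_le ?_ (this.trans_eq ?_) <;>
        exact Finset.sum_congr rfl fun σ _ => iSup_congr fun f => by ring
    have hbd : ∀ (σ : Fin n → Bool) (s : ℝ), |s| = 1 → BddAbove (Set.range fun f =>
        (u f + C * ∑ k, rademacherSign (σ k) * a k.succ f) + s * (C * a 0 f)) := by
      intro σ s hs
      refine bddAbove_range_of_abs_le (B := U + C * ∑ _k : Fin n, B + C * B) fun f => ?_
      refine (abs_add_le _ _).trans (add_le_add ((abs_add_le _ _).trans (add_le_add (hU f) ?_)) ?_)
      · rw [abs_mul, abs_of_nonneg hC]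
        gcongr
        exact (abs_sum_sign_mul_le _ _).trans (Finset.sum_le_sum fun k _ => ha _ _)
      · rw [abs_mul, abs_mul, hs, abs_of_nonneg hC, one_mul]
        gcongr
        exact ha 0 f
    rw [sum_fin_succ_bool, sum_fin_succ_bool, Finset.sum_add_distrib]
    simp only [Fin.sum_univ_succ, Fin.cons_zero, Fin.cons_succ]
    refine (add_le_add (hstep true) (hstep false)).trans ?_
    rw [← Finset.sum_add_distrib]
    refine Finset.sum_le_sum fun σ _ => ?_
    have h := iSup_add_iSup_le_of_lipschitz
      (v := fun f => u f + C * ∑ k, rademacherSign (σ k) * a k.succ f) (hab 0)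
      (by simpa using hbd σ 1 (by simp)) (by simpa [sub_eq_add_neg] using hbd σ (-1) (by simp))
    refine Eq.trans_le ?_ (h.trans_eq ?_) <;> refine congrArg₂ (· + ·) ?_ ?_ <;>
      exact iSup_congr fun f => by
        simp only [rademacherSign, if_true, Bool.false_eq_true, if_false]
        ring

/-- If the signed sums of `a` are bounded above for all signs then `a` itself is bounded: take the
signs of the summands. -/
lemma exists_abs_le_of_bddAbove_sign {ι : Type*} {n : ℕ} {a : Fin n → ι → ℝ}
    (ha : ∀ σ : Fin n → Bool, BddAbove (Set.range fun f => ∑ k, rademacherSign (σ k) * a k f)) :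
    ∃ B, ∀ k f, |a k f| ≤ B := by
  choose U hU using ha
  refine ⟨∑ σ, |U σ|, fun k f => ?_⟩
  have hsign : ∀ x : ℝ, rademacherSign (decide (0 ≤ x)) * x = |x| := fun x => by
    by_cases hx : 0 ≤ x
    · simp [rademacherSign, hx, abs_of_nonneg hx]
    · simp [rademacherSign, hx, abs_of_neg (not_le.1 hx)]
  calc |a k f| ≤ ∑ k, |a k f| :=
        Finset.single_le_sum (f := fun k => |a k f|) (fun _ _ => abs_nonneg _) (Finset.mem_univ k)
    _ = ∑ k, rademacherSign (decide (0 ≤ a k f)) * a k f := by simp only [hsign]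
    _ ≤ U fun k => decide (0 ≤ a k f) := hU (fun k => decide (0 ≤ a k f)) ⟨f, rfl⟩
    _ ≤ |U fun k => decide (0 ≤ a k f)| := le_abs_self _
    _ ≤ ∑ σ, |U σ| := Finset.single_le_sum (f := fun σ => |U σ|) (fun _ _ => abs_nonneg _)
        (Finset.mem_univ _)

/-- The contraction principle without boundedness assumptions besides those which make the
suprema on the larger side genuine. -/
theorem bddAbove_and_sum_iSup_sign_le {ι : Type*} [Nonempty ι] {C : ℝ} (hC : 0 ≤ C) {n : ℕ}
    {a b : Fin n → ι → ℝ} (hab : ∀ k f g, |b k f - b k g| ≤ C * |a k f - a k g|)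
    (ha : ∀ σ : Fin n → Bool, BddAbove (Set.range fun f => ∑ k, rademacherSign (σ k) * a k f)) :
    (∀ σ : Fin n → Bool, BddAbove (Set.range fun f => ∑ k, rademacherSign (σ k) * b k f)) ∧
      ∑ σ : Fin n → Bool, ⨆ f, ∑ k, rademacherSign (σ k) * b k f ≤
        C * ∑ σ : Fin n → Bool, ⨆ f, ∑ k, rademacherSign (σ k) * a k f := by
  obtain ⟨B, hB⟩ := exists_abs_le_of_bddAbove_sign ha
  obtain ⟨f₀⟩ := ‹Nonempty ι›
  have hb : ∀ k f, |b k f| ≤ ∑ k, |b k f₀| + C * (B + B) := by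
    intro k f
    have h1 : |b k f₀| ≤ ∑ k, |b k f₀| :=
      Finset.single_le_sum (f := fun k => |b k f₀|) (fun _ _ => abs_nonneg _) (Finset.mem_univ k)
    have h2 : |a k f - a k f₀| ≤ B + B := (abs_sub _ _).trans (add_le_add (hB k f) (hB k f₀))
    have h3 := hab k f f₀
    have h4 : C * |a k f - a k f₀| ≤ C * (B + B) := mul_le_mul_of_nonneg_left h2 hC
    have h5 := abs_sub_abs_le_abs_sub (b k f) (b k f₀)
    linarith
  have : Nonempty ι := ⟨f₀⟩
  refine ⟨fun σ => bddAbove_range_of_abs_le fun f => (abs_sum_sign_mul_le _ _).trans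
    (Finset.sum_le_sum fun k _ => hb k f), ?_⟩
  have h := sum_iSup_sign_le_of_lipschitz hC a b hab (fun k f => (hB k f).trans (le_max_left B _))
    (fun k f => (hb k f).trans (le_max_right B _)) (fun _ => 0) ⟨0, by simp⟩
  simpa [Finset.mul_sum, Real.mul_iSup_of_nonneg hC] using h

/-! ### Deviations of empirical means -/

section Deviation

lemma abs_sub_le_of_sub_le {Z : Type*} {r : ℝ} {h : Z → ℝ} (hr : ∀ p q, h p - h q ≤ r) (p q : Z) :
    |h p - h q| ≤ r :=
  abs_sub_le_iff.2 ⟨hr p q, hr q p⟩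

variable {Z : Type*} [MeasurableSpace Z] {P : Measure Z} {n : ℕ} {r : ℝ}

/-- The deviation of the expectation of `h` under `P` from its mean over the sample `S`. -/
noncomputable def deviation (P : Measure Z) (h : Z → ℝ) (S : Fin n → Z) : ℝ :=
  ∫ z, h z ∂P - (1 / (n : ℝ)) * ∑ k, h (S k)

lemma integrable_of_sub_le [IsProbabilityMeasure P] {h : Z → ℝ} (hm : Measurable h)
    (hr : ∀ p q, h p - h q ≤ r) : Integrable h P := by
  obtain ⟨p₀⟩ := nonempty_of_isProbabilityMeasure P
  refine integrable_of_forall_abs_le hm (B := |h p₀| + r) fun p => ?_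
  have h1 := hr p p₀
  have h2 := hr p₀ p
  rw [abs_le]
  constructor <;> cases abs_cases (h p₀) <;> linarith

lemma measurable_deviation {h : Z → ℝ} (hm : Measurable h) :
    Measurable (deviation P h : (Fin n → Z) → ℝ) := by
  unfold deviation
  fun_prop

lemma abs_mean_le (hn : 0 < n) {a : Fin n → ℝ} (ha : ∀ k, |a k| ≤ r) :
    |(1 / (n : ℝ)) * ∑ k, a k| ≤ r := by
  have hn' : (0 : ℝ) < n := by exact_mod_cast hn
  rw [abs_mul, abs_of_pos (by positivity), one_div, inv_mul_le_iff₀ hn']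
  exact (Finset.abs_sum_le_sum_abs _ _).trans
    ((Finset.sum_le_sum fun k _ => ha k).trans_eq (by simp))

lemma integral_comp_eval [IsProbabilityMeasure P] {h : Z → ℝ} (hm : Measurable h) (k : Fin n) :
    ∫ S, h (S k) ∂(Measure.pi fun _ : Fin n => P) = ∫ z, h z ∂P := by
  have := measurePreserving_eval (fun _ : Fin n => P) k
  conv_rhs => rw [← this.map_eq]
  rw [integral_map this.measurable.aemeasurable hm.aestronglyMeasurable]

lemma integrable_comp_eval [IsProbabilityMeasure P] {h : Z → ℝ} (hi : Integrable h P) (k : Fin n) :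
    Integrable (fun S => h (S k)) (Measure.pi fun _ : Fin n => P) :=
  (measurePreserving_eval (fun _ : Fin n => P) k).integrable_comp_of_integrable hi

/-- The deviation is an average of differences between an independent second sample and `S`. -/
lemma deviation_eq_integral [IsProbabilityMeasure P] (hn : 0 < n) {h : Z → ℝ} (hm : Measurable h)
    (hr : ∀ p q, h p - h q ≤ r) (S : Fin n → Z) :
    deviation P h S =
      ∫ T, (1 / (n : ℝ)) * ∑ k, (h (T k) - h (S k)) ∂(Measure.pi fun _ : Fin n => P) := by
  have hn' : (n : ℝ) ≠ 0 := by exact_mod_cast hn.ne'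
  have hi := fun k : Fin n => integrable_comp_eval (integrable_of_sub_le (P := P) hm hr) k
  rw [integral_const_mul, integral_finsetSum _ fun k _ => by exact (hi k).sub (integrable_const _)]
  simp_rw [integral_sub (hi _) (integrable_const _), integral_comp_eval hm]
  simp [deviation]
  field_simp

lemma integral_deviation [IsProbabilityMeasure P] (hn : 0 < n) {h : Z → ℝ} (hm : Measurable h)
    (hr : ∀ p q, h p - h q ≤ r) :
    ∫ S, deviation P h S ∂(Measure.pi fun _ : Fin n => P) = 0 := by
  have hn' : (n : ℝ) ≠ 0 := by exact_mod_cast hn.ne'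
  have hi := fun k : Fin n => integrable_comp_eval (integrable_of_sub_le (P := P) hm hr) k
  unfold deviation
  rw [integral_sub (integrable_const _) ((integrable_finsetSum _ fun k _ => hi k).const_mul _),
    integral_const_mul, integral_finsetSum _ fun k _ => hi k]
  simp_rw [integral_comp_eval hm]
  simp
  field_simp
  simp

lemma abs_deviation_le [IsProbabilityMeasure P] (hn : 0 < n) {h : Z → ℝ} (hm : Measurable h)
    (hr : ∀ p q, h p - h q ≤ r) (S : Fin n → Z) : |deviation P h S| ≤ r := by
  rw [deviation_eq_integral hn hm hr, ← Real.norm_eq_abs]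
  refine (norm_integral_le_of_norm_le_const (C := r) (μ := Measure.pi fun _ : Fin n => P)
    (ae_of_all _ fun T => ?_)).trans_eq (by rw [probReal_univ, mul_one])
  exact abs_mean_le hn fun k => abs_sub_le_of_sub_le hr _ _

lemma deviation_le_add {h : Z → ℝ} (hr : ∀ p q, h p - h q ≤ r)
    (k : Fin n) (S T : Fin n → Z) (hST : ∀ j, j ≠ k → S j = T j) :
    deviation P h S ≤ deviation P h T + r / n := by
  have e : ∑ j, h (T j) - ∑ j, h (S j) = h (T k) - h (S k) := by
    rw [← Finset.sum_sub_distrib]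
    exact Finset.sum_eq_single k (fun j _ hj => by rw [hST j hj, sub_self]) (by simp)
  have : (1 / (n : ℝ)) * (∑ j, h (T j) - ∑ j, h (S j)) ≤ (1 / (n : ℝ)) * r := by
    rw [e]
    gcongr
    exact hr _ _
  unfold deviation
  rw [mul_sub, one_div_mul_eq_div _ r] at this
  linarith

lemma deviation_sub {g h : Z → ℝ} (hg : Integrable g P) (hh : Integrable h P)
    (S : Fin n → Z) :
    deviation P (fun z => g z - h z) S = deviation P g S - deviation P h S := by
  unfold deviation
  rw [integral_sub hg hh, Finset.sum_sub_distrib]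
  ring

lemma deviation_sum {κ : Type*} [Fintype κ] {h : κ → Z → ℝ} (hi : ∀ i, Integrable (h i) P)
    (S : Fin n → Z) :
    deviation P (fun z => ∑ i, h i z) S = ∑ i, deviation P (h i) S := by
  unfold deviation
  rw [integral_finsetSum _ fun i _ => hi i, Finset.sum_comm, Finset.mul_sum,
    Finset.sum_sub_distrib]

/-- Deviations pass to pointwise limits. The functions need not be uniformly bounded, but they are
after subtraction of their values at a fixed point, to which deviations are insensitive. -/
lemma tendsto_deviation [IsProbabilityMeasure P] (hn : 0 < n) {h : ℕ → Z → ℝ} {h' : Z → ℝ}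
    (hm : ∀ m, Measurable (h m)) (hr : ∀ m p q, h m p - h m q ≤ r)
    (hm' : Measurable h') (hr' : ∀ p q, h' p - h' q ≤ r)
    (hlim : ∀ z, Tendsto (fun m => h m z) atTop (𝓝 (h' z))) (S : Fin n → Z) :
    Tendsto (fun m => deviation P (h m) S) atTop (𝓝 (deviation P h' S)) := by
  have hn' : (n : ℝ) ≠ 0 := by exact_mod_cast hn.ne'
  obtain ⟨p₀⟩ := nonempty_of_isProbabilityMeasure P
  have hcenter : ∀ g : Z → ℝ, Measurable g → (∀ p q, g p - g q ≤ r) →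
      deviation P g S = ∫ z, (g z - g p₀) ∂P - (1 / (n : ℝ)) * ∑ k, (g (S k) - g p₀) := by
    intro g hg hgr
    rw [integral_sub (integrable_of_sub_le hg hgr) (integrable_const _), deviation]
    simp
    field_simp
    ring
  rw [hcenter h' hm' hr']
  simp_rw [fun m => hcenter (h m) (hm m) (hr m)]
  refine Tendsto.sub ?_ ?_
  · refine tendsto_integral_of_dominated_convergence (fun _ => r)
      (fun m => ((hm m).sub_const _).aestronglyMeasurable) (integrable_const _)
      (fun m => ae_of_all _ fun z => abs_sub_le_of_sub_le (hr m) z p₀)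
      (ae_of_all _ fun z => (hlim z).sub (hlim p₀))
  · exact (tendsto_finsetSum _ fun k _ => (hlim (S k)).sub (hlim p₀)).const_mul _

lemma abs_iSup_le_of_abs_le {ι : Type*} [Nonempty ι] {a : ι → ℝ} (h : ∀ i, |a i| ≤ r) :
    |⨆ i, a i| ≤ r := by
  obtain ⟨i⟩ := ‹Nonempty ι›
  exact abs_le.2 ⟨(abs_le.1 (h i)).1.trans (le_ciSup (bddAbove_range_of_abs_le h) i),
    have : Nonempty ι := ⟨i⟩; ciSup_le fun i => (abs_le.1 (h i)).2⟩

/-- The largest deviation over a countable class is unlikely to exceed its expectation by much. -/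
theorem measureReal_iSup_deviation_ge_le [IsProbabilityMeasure P] {ι : Type*} [Countable ι]
    [Nonempty ι] (hn : 0 < n)
    {h : ι → Z → ℝ} (hm : ∀ i, Measurable (h i)) (hr₀ : 0 < r) (hr : ∀ i p q, h i p - h i q ≤ r)
    {ε : ℝ} (hε : 0 ≤ ε) :
    (Measure.pi fun _ : Fin n => P).real {S | ε ≤ (⨆ i, deviation P (h i) S) -
      ∫ T, ⨆ i, deviation P (h i) T ∂(Measure.pi fun _ : Fin n => P)} ≤
      Real.exp (-2 * n * ε ^ 2 / r ^ 2) := by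
  have hn' : (0 : ℝ) < n := by exact_mod_cast hn
  have hbd := fun S : Fin n → Z => fun i => abs_deviation_le (P := P) hn (hm i) (hr i) S
  obtain ⟨c, hc⟩ : ∃ c : ℝ≥0, (c : ℝ) = r / n := ⟨⟨r / n, by positivity⟩, rfl⟩
  have hsub := hasSubgaussianMGF_of_bounded_differences P c r n
    (fun S => ⨆ i, deviation P (h i) S) (Measurable.iSup fun i => measurable_deviation (hm i))
    (fun S => abs_iSup_le_of_abs_le (hbd S)) fun k S T hST => ciSup_le fun i =>
      (deviation_le_add (hr i) k S T hST).trans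
        (by rw [hc]; gcongr; exact le_ciSup (bddAbove_range_of_abs_le (hbd T)) i)
  refine (hsub.measure_ge_le hε).trans_eq ?_
  congr 1
  push_cast
  rw [hc]
  field_simp

/-! ### Symmetrization -/

/-- Exchanging two independent samples at some of the coordinates preserves their joint law. -/
lemma measurePreserving_exchange (P : Measure Z) [IsProbabilityMeasure P] (σ : Fin n → Bool) :
    MeasurePreserving (fun p : (Fin n → Z) × (Fin n → Z) =>
        ((fun k => if σ k then p.1 k else p.2 k, fun k => if σ k then p.2 k else p.1 k) :
          (Fin n → Z) × (Fin n → Z)))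
      ((Measure.pi fun _ => P).prod (Measure.pi fun _ => P))
      ((Measure.pi fun _ => P).prod (Measure.pi fun _ => P)) := by
  have e := measurePreserving_arrowProdEquivProdArrow Z Z (Fin n) (fun _ => P) (fun _ => P)
  have hflip : MeasurePreserving (fun (q : Fin n → Z × Z) k => if σ k then q k else (q k).swap)
      (Measure.pi fun _ => P.prod P) (Measure.pi fun _ => P.prod P) := by
    refine measurePreserving_pi _ _
      (f := fun k (z : Z × Z) => if σ k then z else z.swap) fun k => ?_
    cases σ k
    · simpa using Measure.measurePreserving_swap
    · exact MeasurePreserving.id _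
  convert e.comp (hflip.comp e.symm) using 1
  funext p
  refine Prod.ext (funext fun k => ?_) (funext fun k => ?_) <;>
    by_cases hk : σ k = true <;>
    simp [hk, MeasurableEquiv.arrowProdEquivProdArrow, Equiv.arrowProdEquivProdArrow]

/-- **Symmetrization**: the expected largest deviation over a countable class is at most twice
every bound in expectation for the Rademacher averages of the class. -/
theorem integral_iSup_deviation_le [IsProbabilityMeasure P] {ι : Type*} [Countable ι] [Nonempty ι]
    (hn : 0 < n)
    {h : ι → Z → ℝ} (hm : ∀ i, Measurable (h i)) (hr : ∀ i p q, h i p - h i q ≤ r)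
    {R : (Fin n → Z) → ℝ} (hR : Integrable R (Measure.pi fun _ => P))
    (hbdd : ∀ᵐ S ∂(Measure.pi fun _ : Fin n => P), ∀ σ : Fin n → Bool,
      BddAbove (Set.range fun i => (1 / (n : ℝ)) * ∑ k, rademacherSign (σ k) * h i (S k)))
    (hle : ∀ᵐ S ∂(Measure.pi fun _ : Fin n => P), (1 / (2 : ℝ) ^ n) * ∑ σ : Fin n → Bool,
      ⨆ i, (1 / (n : ℝ)) * ∑ k, rademacherSign (σ k) * h i (S k) ≤ R S) :
    ∫ S, ⨆ i, deviation P (h i) S ∂(Measure.pi fun _ : Fin n => P) ≤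
      2 * ∫ S, R S ∂(Measure.pi fun _ : Fin n => P) := by
  set μ : Measure (Fin n → Z) := Measure.pi fun _ => P
  let t : (Fin n → Bool) → ι → (Fin n → Z) × (Fin n → Z) → ℝ := fun σ i p =>
    (1 / (n : ℝ)) * ∑ k, rademacherSign (σ k) * (h i (p.2 k) - h i (p.1 k))
  let G : (Fin n → Bool) → (Fin n → Z) × (Fin n → Z) → ℝ := fun σ p => ⨆ i, t σ i p
  have ht : ∀ σ i p, |t σ i p| ≤ r := fun σ i p => abs_mean_le hn fun k => by
    rw [abs_mul, abs_rademacherSign, one_mul]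
    exact abs_sub_le_of_sub_le (hr i) _ _
  have htm : ∀ σ i, Measurable (t σ i) := fun σ i => by
    have := hm i
    fun_prop
  have hGm : ∀ σ, Measurable (G σ) := fun σ => Measurable.iSup fun i => htm σ i
  have hGi : ∀ σ, Integrable (G σ) (μ.prod μ) := fun σ =>
    integrable_of_forall_abs_le (hGm σ) fun p => abs_iSup_le_of_abs_le fun i => ht σ i p
  -- the deviation averages over a second sample, and the supremum of averages is at most the
  -- average of the suprema
  have h1 : ∫ S, ⨆ i, deviation P (h i) S ∂μ ≤ ∫ p, G (fun _ => true) p ∂(μ.prod μ) := by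
    rw [integral_prod _ (hGi _)]
    refine integral_mono (integrable_of_forall_abs_le
      (Measurable.iSup fun i => measurable_deviation (hm i))
      fun S => abs_iSup_le_of_abs_le fun i => abs_deviation_le hn (hm i) (hr i) S)
      (hGi _).integral_prod_left fun S => ciSup_le fun i => ?_
    rw [deviation_eq_integral hn (hm i) (hr i)]
    refine integral_mono (integrable_of_forall_abs_le (B := r) ?_ fun T => ?_)
      (integrable_of_forall_abs_le (B := r) ((hGm _).comp measurable_prodMk_left) fun T =>
        abs_iSup_le_of_abs_le fun i => ht _ i _) fun T => ?_
    · have := hm i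
      fun_prop
    · exact abs_mean_le hn fun k => abs_sub_le_of_sub_le (hr i) _ _
    · refine le_trans (le_of_eq ?_) (le_ciSup (bddAbove_range_of_abs_le fun i => ht _ i (S, T)) i)
      simp [t, rademacherSign]
  have h2 : ∀ σ, ∫ p, G σ p ∂(μ.prod μ) = ∫ p, G (fun _ => true) p ∂(μ.prod μ) := by
    intro σ
    have hx := measurePreserving_exchange (n := n) P σ
    conv_rhs => rw [← hx.map_eq]
    rw [integral_map hx.measurable.aemeasurable (hGm _).aestronglyMeasurable]
    refine integral_congr_ae (ae_of_all _ fun p => iSup_congr fun i => ?_)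
    refine congrArg _ (Finset.sum_congr rfl fun k _ => ?_)
    by_cases hk : σ k = true <;> simp [hk, rademacherSign]
  have h3 : ∫ p, G (fun _ => true) p ∂(μ.prod μ) =
      ∫ p, (1 / (2 : ℝ) ^ n) * ∑ σ, G σ p ∂(μ.prod μ) := by
    rw [integral_const_mul, integral_finsetSum _ fun σ _ => hGi σ]
    simp [h2]
  have h4 : ∀ᵐ p ∂(μ.prod μ), (1 / (2 : ℝ) ^ n) * ∑ σ, G σ p ≤ R p.2 + R p.1 := by
    filter_upwards [Measure.quasiMeasurePreserving_fst.ae hbdd,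
      Measure.quasiMeasurePreserving_snd.ae hbdd, Measure.quasiMeasurePreserving_fst.ae hle,
      Measure.quasiMeasurePreserving_snd.ae hle] with p b1 b2 l1 l2
    refine le_trans ?_ (add_le_add l2 l1)
    -- negating the signs of the first sample only permutes the sign vectors
    have hneg : ∑ σ : Fin n → Bool, ⨆ i, (1 / (n : ℝ)) * ∑ k, rademacherSign (σ k) * h i (p.1 k) =
        ∑ σ : Fin n → Bool, ⨆ i, (1 / (n : ℝ)) * ∑ k, rademacherSign (!σ k) * h i (p.1 k) :=
      ((Equiv.piCongrRight fun _ : Fin n => Equiv.boolNot).sum_comp fun σ : Fin n → Bool =>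
        ⨆ i, (1 / (n : ℝ)) * ∑ k, rademacherSign (σ k) * h i (p.1 k)).symm
    rw [hneg, ← mul_add, ← Finset.sum_add_distrib]
    gcongr with σ
    refine ciSup_le fun i => le_trans (le_of_eq ?_)
      (add_le_add (le_ciSup (b2 σ) i) (le_ciSup (b1 fun k => !σ k) i))
    simp only [t, rademacherSign_not]
    rw [← mul_add, ← Finset.sum_add_distrib]
    refine congrArg _ (Finset.sum_congr rfl fun k _ => by ring)
  have hR2 : Integrable (fun p : (Fin n → Z) × (Fin n → Z) => R p.2) (μ.prod μ) := hR.comp_snd μ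
  have hR1 : Integrable (fun p : (Fin n → Z) × (Fin n → Z) => R p.1) (μ.prod μ) := hR.comp_fst μ
  refine h1.trans (h3.trans_le ?_)
  refine (integral_mono_ae ((integrable_finsetSum _ fun σ _ => hGi σ).const_mul _)
    (hR2.add hR1) h4).trans_eq ?_
  simp only [Pi.add_apply]
  rw [integral_add hR2 hR1, integral_fun_snd, integral_fun_fst]
  simp
  ring

end Deviation

/-! ### The noise correction -/

section Noise

variable {X : Type*} {K n : ℕ} {N : Matrix (Fin K) (Fin K) ℝ}

lemma sum_abs_inv_le_noiseConstant (N : Matrix (Fin K) (Fin K) ℝ) (y : Fin K) :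
    ∑ j, |N⁻¹ y j| ≤ noiseConstant N :=
  le_ciSup (f := fun y => ∑ j, |N⁻¹ y j|) (Set.finite_range _).bddAbove y

lemma noiseConstant_nonneg (N : Matrix (Fin K) (Fin K) ℝ) : 0 ≤ noiseConstant N :=
  Real.iSup_nonneg fun _ => Finset.sum_nonneg fun _ _ => abs_nonneg _

lemma corrected_ordinalLoss (ℓ : Fin (K - 1) → ℝ → Bool → ℝ) (f : OrdinalRegressor X K)
    (p : X × Fin K) :
    corrected N (ordinalLoss ℓ) f p = ∑ i, corrected N (binaryLoss ℓ i) f p := by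
  simp only [corrected, ordinalLoss, Finset.mul_sum]
  exact Finset.sum_comm

/-- Averaging a corrected loss over the noisy label gives back the loss. -/
lemma sum_mul_corrected (hN : IsNoiseMatrix N) (l : OrdinalRegressor X K → X × Fin K → ℝ)
    (f : OrdinalRegressor X K) (p : X × Fin K) :
    ∑ j, N p.2 j * corrected N l f (p.1, j) = l f p := by
  have h : ∀ k, ∑ j, N p.2 j * N⁻¹ j k = if p.2 = k then 1 else 0 := fun k => by
    rw [← Matrix.mul_apply, Matrix.mul_nonsing_inv _ hN.invertible, Matrix.one_apply]
  simp only [corrected, Finset.mul_sum, ← mul_assoc]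
  rw [Finset.sum_comm]
  simp [← Finset.sum_mul, h]

lemma abs_corrected_binaryLoss_sub_le {ℓ : Fin (K - 1) → ℝ → Bool → ℝ} {L : ℝ≥0}
    (hL : ∀ i z, LipschitzWith L (fun t => ℓ i t z)) (i : Fin (K - 1))
    (f g : OrdinalRegressor X K) (p : X × Fin K) :
    |corrected N (binaryLoss ℓ i) f p - corrected N (binaryLoss ℓ i) g p| ≤
      noiseConstant N * L * |f.binaryScore i p.1 - g.binaryScore i p.1| := by
  unfold corrected
  rw [← Finset.sum_sub_distrib, mul_assoc]
  calc |∑ j, (N⁻¹ p.2 j * binaryLoss ℓ i f (p.1, j) - N⁻¹ p.2 j * binaryLoss ℓ i g (p.1, j))|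
      ≤ ∑ j, |N⁻¹ p.2 j| * (L * |f.binaryScore i p.1 - g.binaryScore i p.1|) := by
        refine (Finset.abs_sum_le_sum_abs _ _).trans (Finset.sum_le_sum fun j _ => ?_)
        rw [← mul_sub, abs_mul]
        gcongr
        simpa [Real.dist_eq, binaryLoss] using
          (hL i (binaryLabel i j)).dist_le_mul (f.binaryScore i p.1) (g.binaryScore i p.1)
    _ ≤ noiseConstant N * (L * |f.binaryScore i p.1 - g.binaryScore i p.1|) := by
        rw [← Finset.sum_mul]
        gcongr
        exact sum_abs_inv_le_noiseConstant N p.2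

lemma tendsto_corrected_binaryLoss {ℓ : Fin (K - 1) → ℝ → Bool → ℝ} {L : ℝ≥0}
    (hL : ∀ i z, LipschitzWith L (fun t => ℓ i t z)) {u : ℕ → OrdinalRegressor X K}
    {f : OrdinalRegressor X K} {i : Fin (K - 1)}
    (hu : ∀ x, Tendsto (fun m => (u m).binaryScore i x) atTop (𝓝 (f.binaryScore i x)))
    (p : X × Fin K) :
    Tendsto (fun m => corrected N (binaryLoss ℓ i) (u m) p) atTop
      (𝓝 (corrected N (binaryLoss ℓ i) f p)) :=
  tendsto_finsetSum _ fun j _ =>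
    (((hL i (binaryLabel i j)).continuous.tendsto _).comp (hu p.1)).const_mul _

variable [MeasurableSpace X] {D : Measure (X × Fin K)}

lemma measurable_corrected_binaryLoss {ℓ : Fin (K - 1) → ℝ → Bool → ℝ} {L : ℝ≥0}
    (hL : ∀ i z, LipschitzWith L (fun t => ℓ i t z)) (i : Fin (K - 1))
    {f : OrdinalRegressor X K} (hf : Measurable f.g) :
    Measurable (corrected N (binaryLoss ℓ i) f) := by
  refine measurable_from_prod_countable_left fun y => ?_
  refine Finset.measurable_sum _ fun j _ => Measurable.const_mul (f := fun x =>
    ℓ i (f.binaryScore i x) (binaryLabel i j)) ?_ (N⁻¹ y j)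
  exact (hL i (binaryLabel i j)).continuous.measurable.comp (hf.add_const _)

/-! ### The law of the noisy data -/

lemma measurable_noise (N : Matrix (Fin K) (Fin K) ℝ) (j : Fin K) :
    Measurable fun p : X × Fin K => N p.2 j :=
  (measurable_of_finite fun y : Fin K => N y j).comp measurable_snd

lemma lintegral_noisyLaw {φ : X × Fin K → ENNReal} (hφ : Measurable φ) :
    ∫⁻ p, φ p ∂(noisyLaw N D) =
      ∫⁻ p, ∑ j, ENNReal.ofReal (N p.2 j) * φ (p.1, j) ∂D := by
  have hN : ∀ j, Measurable fun p : X × Fin K => ENNReal.ofReal (N p.2 j) := fun j =>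
    (measurable_noise N j).ennreal_ofReal
  have hj : ∀ j : Fin K, Measurable fun p : X × Fin K => (p.1, j) := fun j =>
    measurable_fst.prodMk measurable_const
  rw [noisyLaw, lintegral_finsetSum_measure,
    lintegral_finsetSum _ fun j _ => by exact (hN j).mul (hφ.comp (hj j))]
  refine Finset.sum_congr rfl fun j _ => ?_
  rw [lintegral_map hφ (hj j)]
  exact lintegral_withDensity_eq_lintegral_mul _ (hN j) (hφ.comp (hj j))

lemma sum_ofReal_noise (hN : IsNoiseMatrix N) (y : Fin K) :
    ∑ j, ENNReal.ofReal (N y j) = 1 := by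
  rw [← ENNReal.ofReal_sum_of_nonneg fun j _ => hN.nonneg y j, hN.row_sum, ENNReal.ofReal_one]

/-- The noise changes the labels only. -/
lemma fst_noisyLaw (hN : IsNoiseMatrix N) : (noisyLaw N D).fst = D.fst := by
  refine Measure.ext_of_lintegral _ fun φ hφ => ?_
  rw [Measure.fst, Measure.fst, lintegral_map hφ measurable_fst, lintegral_map hφ measurable_fst,
    lintegral_noisyLaw (φ := fun p => φ p.1) (hφ.comp measurable_fst)]
  simp [← Finset.sum_mul, sum_ofReal_noise hN]

lemma isProbabilityMeasure_noisyLaw [IsProbabilityMeasure D] (hN : IsNoiseMatrix N) :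
    IsProbabilityMeasure (noisyLaw N D) :=
  ⟨by rw [← Measure.fst_univ, fst_noisyLaw hN, measure_univ]⟩

lemma integral_noisyLaw [IsProbabilityMeasure D] (hN : IsNoiseMatrix N) {h : X × Fin K → ℝ}
    (hi : Integrable h (noisyLaw N D)) (hm : Measurable h) :
    ∫ p, h p ∂(noisyLaw N D) = ∑ j, ∫ p, N p.2 j * h (p.1, j) ∂D := by
  have hNm : ∀ j, Measurable fun p : X × Fin K => ENNReal.ofReal (N p.2 j) := fun j =>
    (measurable_noise N j).ennreal_ofReal
  have hj : ∀ j : Fin K, Measurable fun p : X × Fin K => (p.1, j) := fun j =>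
    measurable_fst.prodMk measurable_const
  rw [noisyLaw] at hi ⊢
  rw [integral_finsetSum_measure fun j hjm => (integrable_finsetSum_measure.1 hi) j hjm]
  refine Finset.sum_congr rfl fun j _ => ?_
  rw [integral_map (hj j).aemeasurable hm.aestronglyMeasurable,
    integral_withDensity_eq_integral_toReal_smul (hNm j)
      (ae_of_all _ fun _ => ENNReal.ofReal_lt_top)]
  simp [ENNReal.toReal_ofReal (hN.nonneg _ _)]

/-- The corrected loss has under the noisy law the risk of the loss under the clean law. -/
lemma integral_corrected_noisyLaw [IsProbabilityMeasure D] (hN : IsNoiseMatrix N)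
    {l : OrdinalRegressor X K → X × Fin K → ℝ} {f : OrdinalRegressor X K}
    (hm : Measurable (corrected N l f)) {r : ℝ}
    (hr : ∀ p q, corrected N l f p - corrected N l f q ≤ r) :
    ∫ p, corrected N l f p ∂(noisyLaw N D) = risk l D f := by
  have := isProbabilityMeasure_noisyLaw (D := D) hN
  obtain ⟨p₀⟩ := nonempty_of_isProbabilityMeasure D
  have hi : ∀ j, Integrable (fun p : X × Fin K => N p.2 j * corrected N l f (p.1, j)) D := by
    intro j
    have hc : Integrable (fun p : X × Fin K => corrected N l f (p.1, j)) D :=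
      integrable_of_sub_le (hm.comp (by fun_prop)) fun p q => hr (p.1, j) (q.1, j)
    refine hc.bdd_mul (c := 1) (measurable_noise N j).aestronglyMeasurable (ae_of_all _ fun p => ?_)
    rw [Real.norm_of_nonneg (hN.nonneg _ _), ← hN.row_sum p.2]
    exact Finset.single_le_sum (fun k _ => hN.nonneg p.2 k) (Finset.mem_univ j)
  rw [integral_noisyLaw hN (integrable_of_sub_le hm hr) hm, ← integral_finsetSum _ fun j _ => hi j]
  exact integral_congr_ae (ae_of_all _ fun p => sum_mul_corrected hN l f p)

/-! ### The excess risk -/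

/-- Symmetrization and contraction together, for the corrected loss of one binary classifier. -/
lemma integral_iSup_deviation_corrected_le [IsProbabilityMeasure D] (hn : 0 < n)
    (hN : IsNoiseMatrix N) {ℓ : Fin (K - 1) → ℝ → Bool → ℝ} {L : ℝ≥0}
    (hL : ∀ i z, LipschitzWith L (fun t => ℓ i t z)) {F F₀ : Set (OrdinalRegressor X K)}
    (hmeas : ∀ f ∈ F, Measurable f.g) (hF₀ : F₀ ⊆ F) (hcount : F₀.Countable)
    (hne : F₀.Nonempty) (i : Fin (K - 1)) {r : ℝ}
    (hr : ∀ f ∈ F, ∀ p q, corrected N (binaryLoss ℓ i) f p - corrected N (binaryLoss ℓ i) f q ≤ r)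
    (hfin : FiniteRademacher n D.fst (binaryClass F i)) :
    ∫ S, ⨆ f : F₀, deviation (noisyLaw N D) (corrected N (binaryLoss ℓ i) f.1) S
        ∂(Measure.pi fun _ : Fin n => noisyLaw N D) ≤
      2 * (noiseConstant N * L * rademacher n D.fst (binaryClass F i)) := by
  have := isProbabilityMeasure_noisyLaw (D := D) hN
  have := hcount.to_subtype
  have := hne.to_subtype
  have hC : 0 ≤ noiseConstant N * L := mul_nonneg (noiseConstant_nonneg N) L.2
  have hfst : MeasurePreserving (fun (S : Fin n → X × Fin K) k => (S k).1)
      (Measure.pi fun _ => noisyLaw N D) (Measure.pi fun _ => D.fst) :=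
    measurePreserving_pi _ _ fun _ => ⟨measurable_fst, fst_noisyLaw hN⟩
  have key : ∀ᵐ S ∂(Measure.pi fun _ : Fin n => noisyLaw N D),
      (∀ σ : Fin n → Bool, BddAbove (Set.range fun f : F₀ =>
        (1 / (n : ℝ)) * ∑ k, rademacherSign (σ k) * corrected N (binaryLoss ℓ i) f.1 (S k))) ∧
      (1 / (2 : ℝ) ^ n) * ∑ σ : Fin n → Bool, ⨆ f : F₀,
        (1 / (n : ℝ)) * ∑ k, rademacherSign (σ k) * corrected N (binaryLoss ℓ i) f.1 (S k) ≤
      noiseConstant N * L * empiricalRademacher (binaryClass F i) fun k => (S k).1 := by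
    filter_upwards [hfst.quasiMeasurePreserving.ae hfin.1] with S hS
    have hmem : ∀ (σ : Fin n → Bool) (f : F₀),
        ∑ k, rademacherSign (σ k) * (1 / (n : ℝ) * f.1.binaryScore i (S k).1) ∈
          signedMeans (binaryClass F i) (fun k => (S k).1) σ := fun σ f =>
      ⟨_, ⟨f.1, hF₀ f.2, rfl⟩, by simp only [Finset.mul_sum, mul_left_comm]⟩
    have hcontr := bddAbove_and_sum_iSup_sign_le hC
      (a := fun k (f : F₀) => 1 / (n : ℝ) * f.1.binaryScore i (S k).1)
      (b := fun k (f : F₀) => 1 / (n : ℝ) * corrected N (binaryLoss ℓ i) f.1 (S k))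
      (fun k f g => by
        rw [← mul_sub, ← mul_sub, abs_mul, abs_mul, mul_left_comm]
        gcongr
        exact abs_corrected_binaryLoss_sub_le hL i f.1 g.1 (S k))
      (fun σ => (hS σ).mono (by rintro _ ⟨f, rfl⟩; exact hmem σ f))
    simp only [Finset.mul_sum (s := Finset.univ (α := Fin n)), mul_left_comm (1 / (n : ℝ))]
    refine ⟨hcontr.1, (mul_le_mul_of_nonneg_left hcontr.2 (by positivity)).trans ?_⟩
    rw [empiricalRademacher, mul_left_comm]
    gcongr with σ
    exact ciSup_le fun f => le_csSup (hS σ) (hmem σ f)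
  have hR : Integrable (fun S : Fin n → X × Fin K => noiseConstant N * L *
      empiricalRademacher (binaryClass F i) fun k => (S k).1)
      (Measure.pi fun _ => noisyLaw N D) :=
    (hfst.integrable_comp_of_integrable hfin.2).const_mul _
  refine (integral_iSup_deviation_le hn
    (fun f : F₀ => measurable_corrected_binaryLoss hL i (hmeas f.1 (hF₀ f.2)))
    (fun f => hr f.1 (hF₀ f.2)) hR (key.mono fun S h => h.1)
    (key.mono fun S h => h.2)).trans_eq ?_
  rw [integral_const_mul, rademacher, ← hfst.map_eq, integral_map hfst.measurable.aemeasurable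
    (by rw [hfst.map_eq]; exact hfin.2.aestronglyMeasurable)]

end Noise

theorem theorem4 {X : Type*} [MeasurableSpace X] (K n : ℕ) (hn : 0 < n)
    (D : Measure (X × Fin K)) [IsProbabilityMeasure D]
    (N : Matrix (Fin K) (Fin K) ℝ) (hN : IsNoiseMatrix N)
    (ℓ : Fin (K - 1) → ℝ → Bool → ℝ) (L : ℝ≥0)
    (hL : ∀ i z, LipschitzWith L (fun t => ℓ i t z))
    (F : Set (OrdinalRegressor X K)) (hF : IsMeasurableClass F)
    (hrange : ∀ f ∈ F, ∀ i, ∀ p q : X × Fin K,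
      corrected N (binaryLoss ℓ i) f p - corrected N (binaryLoss ℓ i) f q ≤ 1)
    (hfin : ∀ i, FiniteRademacher n D.fst (binaryClass F i))
    (fstar : OrdinalRegressor X K) (hstar : IsMinimizer (risk (ordinalLoss ℓ) D) F fstar)
    (δ : ℝ) (hδ₀ : 0 < δ) (hδ₁ : δ < 1) :
    ∃ E : Set (Fin n → X × Fin K), MeasurableSet E ∧
      ENNReal.ofReal (1 - δ) ≤ Measure.pi (fun _ : Fin n => noisyLaw N D) E ∧
      ∀ S ∈ E, ∀ fhat : OrdinalRegressor X K,
        IsMinimizer (empiricalRisk (corrected N (ordinalLoss ℓ)) S) F fhat →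
        risk (ordinalLoss ℓ) D fhat ≤ risk (ordinalLoss ℓ) D fstar +
          2 * ((K : ℝ) - 1) *
            (2 * noiseConstant N * (L : ℝ) * ordinalRademacher n D.fst F +
              Real.sqrt (Real.log (1 / δ) / (2 * (n : ℝ)))) := by
  have := isProbabilityMeasure_noisyLaw (D := D) hN
  have hn' : (0 : ℝ) < n := by exact_mod_cast hn
  have hK : 1 ≤ K := by
    obtain ⟨p⟩ := nonempty_of_isProbabilityMeasure D
    exact p.2.pos
  have hcard : ((K - 1 : ℕ) : ℝ) = (K : ℝ) - 1 := by push_cast [hK]; rfl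
  rcases hK.eq_or_lt with rfl | hK2
  · -- without thresholds all risks vanish
    exact ⟨Set.univ, MeasurableSet.univ, by simp [hδ₀.le], fun S _ fhat _ => by
      simp [risk, ordinalLoss]⟩
  have hK2' : (0 : ℝ) < (K : ℝ) - 1 := by
    have : (1 : ℝ) < K := by exact_mod_cast hK2
    linarith
  obtain ⟨F₀, hF₀, hcount, hdense⟩ := hF.separable
  have hne : F₀.Nonempty := by
    obtain ⟨u, hu, -⟩ := hdense fstar hstar.1
    exact ⟨u 0, hu 0⟩
  have := hcount.to_subtype
  have := hne.to_subtype
  set P := noisyLaw N D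
  set μ : Measure (Fin n → X × Fin K) := Measure.pi fun _ => P
  set ε : ℝ := 2 * ((K : ℝ) - 1) * Real.sqrt (Real.log (1 / δ) / (2 * (n : ℝ))) with hε
  let h : OrdinalRegressor X K → X × Fin K → ℝ := corrected N (ordinalLoss ℓ)
  have hm : ∀ i, ∀ f ∈ F, Measurable (corrected N (binaryLoss ℓ i) f) := fun i f hf =>
    measurable_corrected_binaryLoss hL i (hF.measurable f hf)
  have hsum : ∀ f, h f = fun p => ∑ i, corrected N (binaryLoss ℓ i) f p := fun f =>
    funext fun p => corrected_ordinalLoss ℓ f p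
  have hhm : ∀ f ∈ F, Measurable (h f) := fun f hf => by
    rw [hsum]
    exact Finset.measurable_sum _ fun i _ => hm i f hf
  have hhr : ∀ f ∈ F, ∀ p q, h f p - h f q ≤ (K : ℝ) - 1 := by
    intro f hf p q
    rw [hsum, ← Finset.sum_sub_distrib]
    exact (Finset.sum_le_sum fun i _ => hrange f hf i p q).trans_eq (by simp [hcard])
  have hhi : ∀ f ∈ F, Integrable (h f) P := fun f hf =>
    integrable_of_sub_le (hhm f hf) (hhr f hf)
  have hdev : ∀ f ∈ F, ∀ S : Fin n → X × Fin K, deviation P (h f) S =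
      risk (ordinalLoss ℓ) D f - empiricalRisk (corrected N (ordinalLoss ℓ)) S f := by
    intro f hf S
    rw [deviation, integral_corrected_noisyLaw hN (hhm f hf) (hhr f hf)]
    rfl
  -- Subtracting the loss of `fstar` inside the supremum makes one concentration inequality
  -- suffice, for a class with twice the range.
  let d : OrdinalRegressor X K → X × Fin K → ℝ := fun f p => h f p - h fstar p
  have hdm : ∀ f ∈ F, Measurable (d f) := fun f hf => (hhm f hf).sub (hhm fstar hstar.1)
  have hdr : ∀ f ∈ F, ∀ p q, d f p - d f q ≤ 2 * ((K : ℝ) - 1) := fun f hf p q => by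
    have h1 := hhr f hf p q
    have h2 := hhr fstar hstar.1 q p
    simp only [d]
    linarith
  let φ : (Fin n → X × Fin K) → ℝ := fun S => ⨆ f : F₀, deviation P (d f.1) S
  have hφm : Measurable φ := Measurable.iSup fun f => measurable_deviation (hdm f.1 (hF₀ f.2))
  have hφb : ∀ S : Fin n → X × Fin K,
      BddAbove (Set.range fun f : F₀ => deviation P (d f.1) S) := fun S =>
    bddAbove_range_of_abs_le fun f =>
      abs_deviation_le hn (hdm f.1 (hF₀ f.2)) (hdr f.1 (hF₀ f.2)) S
  have hφF : ∀ f ∈ F, ∀ S, deviation P (d f) S ≤ φ S := by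
    intro f hf S
    obtain ⟨u, huF, hu⟩ := hdense f hf
    refine le_of_tendsto' (tendsto_deviation (P := P) hn (fun m => hdm (u m) (hF₀ (huF m)))
      (fun m => hdr (u m) (hF₀ (huF m))) (hdm f hf) (hdr f hf) (fun p => ?_) S)
      fun m => le_ciSup (hφb S) ⟨u m, huF m⟩
    refine Tendsto.sub_const ?_ _
    simp only [hsum]
    exact tendsto_finsetSum _ fun i _ => tendsto_corrected_binaryLoss hL (hu i) p
  have hbin : ∀ i, ∀ S : Fin n → X × Fin K, ∀ f : F₀,
      |deviation P (corrected N (binaryLoss ℓ i) f.1) S| ≤ 1 := fun i S f =>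
    abs_deviation_le hn (hm i f.1 (hF₀ f.2)) (hrange f.1 (hF₀ f.2) i) S
  have hsupi : ∀ i, Integrable (fun S : Fin n → X × Fin K =>
      ⨆ f : F₀, deviation P (corrected N (binaryLoss ℓ i) f.1) S) μ := fun i =>
    integrable_of_forall_abs_le (Measurable.iSup fun f : F₀ =>
      measurable_deviation (hm i f.1 (hF₀ f.2))) fun S => abs_iSup_le_of_abs_le (hbin i S)
  have hrad : ∀ i, ∫ S, ⨆ f : F₀, deviation P (corrected N (binaryLoss ℓ i) f.1) S ∂μ ≤
      2 * (noiseConstant N * L * ordinalRademacher n D.fst F) := by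
    intro i
    refine (integral_iSup_deviation_corrected_le hn hN hL hF.measurable hF₀ hcount hne i
      (fun f hf => hrange f hf i) (hfin i)).trans ?_
    have hC : 0 ≤ noiseConstant N * L := mul_nonneg (noiseConstant_nonneg N) L.2
    gcongr
    exact le_ciSup (f := fun i => rademacher n D.fst (binaryClass F i))
      (Set.finite_range _).bddAbove i
  have hrad₀ : 0 ≤ noiseConstant N * L * ordinalRademacher n D.fst F := by
    obtain ⟨f₀⟩ := hne.to_subtype
    let i₀ : Fin (K - 1) := ⟨0, by omega⟩
    have h0 := integral_deviation (P := P) hn (hm i₀ f₀.1 (hF₀ f₀.2)) (hrange f₀.1 (hF₀ f₀.2) i₀)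
    have h1 : ∫ S, deviation P (corrected N (binaryLoss ℓ i₀) f₀.1) S ∂μ ≤
        ∫ S, ⨆ f : F₀, deviation P (corrected N (binaryLoss ℓ i₀) f.1) S ∂μ :=
      integral_mono (integrable_of_forall_abs_le (measurable_deviation (hm i₀ f₀.1 (hF₀ f₀.2)))
        fun S => hbin i₀ S f₀) (hsupi i₀) fun S =>
          le_ciSup (bddAbove_range_of_abs_le (hbin i₀ S)) f₀
    have h2 := hrad i₀
    rw [h0] at h1
    linarith
  have hEφ : ∫ S, φ S ∂μ ≤
      2 * ((K : ℝ) - 1) * (noiseConstant N * L * ordinalRademacher n D.fst F) := by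
    have hstari : Integrable (fun S : Fin n → X × Fin K => deviation P (h fstar) S) μ :=
      integrable_of_forall_abs_le (measurable_deviation (hhm fstar hstar.1))
        (abs_deviation_le hn (hhm fstar hstar.1) (hhr fstar hstar.1))
    have hle : ∀ S, φ S ≤ ∑ i, (⨆ f : F₀, deviation P (corrected N (binaryLoss ℓ i) f.1) S) -
        deviation P (h fstar) S := by
      intro S
      refine ciSup_le fun f => ?_
      rw [deviation_sub (hhi f.1 (hF₀ f.2)) (hhi fstar hstar.1), hsum f.1,
        deviation_sum fun i => integrable_of_sub_le (hm i f.1 (hF₀ f.2))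
          (hrange f.1 (hF₀ f.2) i)]
      gcongr with i
      exact le_ciSup (bddAbove_range_of_abs_le (hbin i S)) f
    calc ∫ S, φ S ∂μ
        ≤ ∫ S, (∑ i, (⨆ f : F₀, deviation P (corrected N (binaryLoss ℓ i) f.1) S) -
            deviation P (h fstar) S) ∂μ :=
          integral_mono (integrable_of_forall_abs_le hφm fun S => abs_iSup_le_of_abs_le fun f =>
            abs_deviation_le hn (hdm f.1 (hF₀ f.2)) (hdr f.1 (hF₀ f.2)) S)
            ((integrable_finsetSum _ fun i _ => hsupi i).sub hstari) hle
      _ = ∑ i, ∫ S, ⨆ f : F₀, deviation P (corrected N (binaryLoss ℓ i) f.1) S ∂μ := by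
          rw [integral_sub (integrable_finsetSum _ fun i _ => hsupi i) hstari,
            integral_finsetSum _ fun i _ => hsupi i,
            integral_deviation hn (hhm fstar hstar.1) (hhr fstar hstar.1), sub_zero]
      _ ≤ ∑ _i : Fin (K - 1), 2 * (noiseConstant N * L * ordinalRademacher n D.fst F) :=
          Finset.sum_le_sum fun i _ => hrad i
      _ = 2 * ((K : ℝ) - 1) * (noiseConstant N * L * ordinalRademacher n D.fst F) := by
          simp only [Finset.sum_const, Finset.card_univ, Fintype.card_fin, nsmul_eq_mul, hcard]
          ring
  have hlog : 0 ≤ Real.log (1 / δ) := Real.log_nonneg (by rw [le_div_iff₀ hδ₀]; linarith)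
  have hbad : μ.real {S | ε ≤ φ S - ∫ T, φ T ∂μ} ≤ δ := by
    refine (measureReal_iSup_deviation_ge_le hn (fun f : F₀ => hdm f.1 (hF₀ f.2))
      (by positivity : 0 < 2 * ((K : ℝ) - 1)) (fun f => hdr f.1 (hF₀ f.2))
      (by positivity : 0 ≤ ε)).trans_eq ?_
    rw [← Real.exp_log hδ₀]
    congr 1
    rw [hε, mul_pow, Real.sq_sqrt (by positivity), one_div, Real.log_inv]
    field_simp
  have hbadm : MeasurableSet {S | ε ≤ φ S - ∫ T, φ T ∂μ} :=
    measurableSet_le measurable_const (hφm.sub_const _)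
  refine ⟨{S | ε ≤ φ S - ∫ T, φ T ∂μ}ᶜ, hbadm.compl, ?_, fun S hS fhat hhat => ?_⟩
  · rw [← ofReal_measureReal, probReal_compl_eq_one_sub hbadm]
    exact ENNReal.ofReal_le_ofReal (by linarith)
  · have h1 : φ S - ∫ T, φ T ∂μ < ε := not_le.1 hS
    have h2 := hφF fhat hhat.1 S
    rw [deviation_sub (hhi fhat hhat.1) (hhi fstar hstar.1), hdev fhat hhat.1,
      hdev fstar hstar.1] at h2
    have h3 := hhat.2 fstar hstar.1
    have h4 : 0 ≤ 2 * ((K : ℝ) - 1) * (noiseConstant N * L * ordinalRademacher n D.fst F) := by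
      positivity
    rw [mul_add, ← hε]
    linarith
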